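/- Let $d\ge 2$ and $r\ge 1$ be integers, and let $\phi=[\phi_1,\dots,\phi_r]^T:\mathbb{R}\to\mathbb{K}^r$ ($\mathbb{K}=\mathbb{R}$ or $\mathbb{C}$) be a two-direction multiscaling function of multiplicity $r$ and dilation factor $d$. This means that there are real $r\times r$ matrices $P_k^+,P_k^-$ ($k\in\mathbb{Z}$) with $$\phi(x)=\sqrt d\sum_{k\in\mathbb{Z}}\bigl[P_k^+\phi(dx-k)+P_k^-\phi(k-dx)\bigr]\qquad(x\in\mathbb{R}),$$ and that $\phi$ generates a multiresolution approximation of $L^2(\mathbb{R})$: the closed linear spans $V_n$ ($n\in\mathbb{Z}$) in $L^2(\mathbb{R})$ of the functions $\phi_i(d^nx-k)$, $\phi_i(k-d^nx)$ ($1\le i\le r$, $k\in\mathbb{Z}$) are nested ($V_n\subset V_{n+1}$), have dense union and intersection $\{0\}$, satisfy $f\in V_n\iff f(d\,\cdot)\in V_{n+1}$ and $f\in V_n\iff f(\cdot-d^{-n}k)\in V_n$ for all $k\in\mathbb{Z}$, and the functions $\phi_i(x-k)$, $\phi_i(k-x)$ form a Riesz basis of $V_0$. Assume that $\phi$ is continuous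 and compactly supported; that $\phi$ is orthogonal, i.e. for all $j,k\in\mathbb{Z}$ $$\int_{\mathbb{R}}\phi(x-j)\,\phi(x-k)^*\,dx=\delta_{jk}I_r,\qquad \int_{\mathbb{R}}\phi(x-j)\,\phi(k-x)^*\,dx=O;$$ and that $\phi$ satisfies Condition E: the matrix $$\frac1{\sqrt d}\sum_{k\in\mathbb{Z}}\begin{bmatrix}P_k^+&P_k^-\\P_{-k}^-&P_{-k}^+\end{bmatrix}$$ has $1$ as a simple eigenvalue, and all its other (complex) eigenvalues are smaller than $1$ in absolute value. Then the zeroth continuous moment $\mathbf m_0=\int_{-\infty}^{\infty}\phi(x)\,dx\in\mathbb{K}^r$ satisfies $$\mathbf m_0^*\,\mathbf m_0=\frac12 .$$ -/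

import Mathlib

open MeasureTheory Matrix

namespace TwoDirection

/-- The matrix-valued inner product `⟨f, g⟩ = ∫ f(x) g(x)^* dx` of two vector-valued functions. -/
noncomputable def innerMatrix {𝕜 : Type*} [RCLike 𝕜] {r : ℕ} (f g : ℝ → Fin r → 𝕜) :
    Matrix (Fin r) (Fin r) 𝕜 :=
  Matrix.of fun i j => ∫ x : ℝ, f x i * star (g x j)

/-- Orthogonality of `φ`: for all integers `j`, `k`,
`⟨φ(x - j), φ(x - k)⟩ = δ_{jk} I_r` and `⟨φ(x - j), φ(k - x)⟩ = O`. -/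
structure IsOrthogonal {𝕜 : Type*} [RCLike 𝕜] {r : ℕ} (φ : ℝ → Fin r → 𝕜) : Prop where
  same : ∀ j k : ℤ,
    innerMatrix (fun x => φ (x - j)) (fun x => φ (x - k)) = if j = k then 1 else 0
  cross : ∀ j k : ℤ,
    innerMatrix (fun x => φ (x - j)) (fun x => φ (k - x)) = 0

/-- The scalar functions `φ_i(d^n x - k)` (left summand) and `φ_i(k - d^n x)` (right summand). -/
noncomputable def dilates {𝕜 : Type*} {r : ℕ} (d : ℕ) (φ : ℝ → Fin r → 𝕜) (n : ℤ) :
    (ℤ × Fin r) ⊕ (ℤ × Fin r) → ℝ → 𝕜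
  | Sum.inl (k, i) => fun x => φ ((d : ℝ) ^ n * x - k) i
  | Sum.inr (k, i) => fun x => φ (k - (d : ℝ) ^ n * x) i

/-- The subspace `V_n` of `L²(ℝ)`: the closed linear span of all the functions
`φ_i(d^n x - k)` and `φ_i(k - d^n x)`, `k ∈ ℤ`. -/
noncomputable def scalingSpace {𝕜 : Type*} [RCLike 𝕜] {r : ℕ} (d : ℕ) (φ : ℝ → Fin r → 𝕜)
    (n : ℤ) : Submodule 𝕜 (Lp 𝕜 2 (volume : Measure ℝ)) :=
  (Submodule.span 𝕜
    {f : Lp 𝕜 2 (volume : Measure ℝ) | ∃ e, f =ᵐ[volume] dilates d φ n e}).topologicalClosure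

/-- A multiresolution approximation of `L²(ℝ)` with dilation factor `d`: nested closed subspaces
with dense union and trivial intersection, compatible with dilations and translations. -/
structure IsMultiresolution {𝕜 : Type*} [RCLike 𝕜] (d : ℕ)
    (V : ℤ → Submodule 𝕜 (Lp 𝕜 2 (volume : Measure ℝ))) : Prop where
  closed : ∀ n, IsClosed (V n : Set (Lp 𝕜 2 (volume : Measure ℝ)))
  nested : ∀ n, V n ≤ V (n + 1)
  dense : Dense (⋃ n, (V n : Set (Lp 𝕜 2 (volume : Measure ℝ))))
  trivial_inter : ⨅ n, V n = ⊥
  dilation : ∀ (n : ℤ) (f g : Lp 𝕜 2 (volume : Measure ℝ)),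
    g =ᵐ[volume] (fun x => f ((d : ℝ) * x)) → (f ∈ V n ↔ g ∈ V (n + 1))
  translation : ∀ (n k : ℤ) (f g : Lp 𝕜 2 (volume : Measure ℝ)),
    g =ᵐ[volume] (fun x => f (x - (d : ℝ) ^ (-n) * k)) → (f ∈ V n ↔ g ∈ V n)

/-- `L²`-stability: the functions `φ_i(x - k)`, `φ_i(k - x)` form a Riesz sequence. -/
def IsStable {𝕜 : Type*} [RCLike 𝕜] {r : ℕ} (d : ℕ) (φ : ℝ → Fin r → 𝕜) : Prop :=
  ∃ A B : ℝ, 0 < A ∧ 0 < B ∧ ∀ c : ((ℤ × Fin r) ⊕ (ℤ × Fin r)) →₀ 𝕜,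
    A * (∑ e ∈ c.support, ‖c e‖ ^ 2)
        ≤ ∫ x : ℝ, ‖∑ e ∈ c.support, c e * dilates d φ 0 e x‖ ^ 2 ∧
      ∫ x : ℝ, ‖∑ e ∈ c.support, c e * dilates d φ 0 e x‖ ^ 2
        ≤ B * (∑ e ∈ c.support, ‖c e‖ ^ 2)

/-- `φ` is a two-direction multiscaling function of multiplicity `r` and dilation factor `d` with
real recursion coefficients `P_k^+ = Pp k`, `P_k^- = Pm k`: it satisfies
`φ(x) = √d ∑_k [P_k^+ φ(dx - k) + P_k^- φ(k - dx)]`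
and generates a multiresolution approximation of `L²(ℝ)`, that is, the spaces `V_n` spanned by it
form a multiresolution approximation and `φ_i(x - k)`, `φ_i(k - x)` are a Riesz basis of `V_0`.
(For compactly supported `φ` all but finitely many terms of the series vanish at each `x`.) -/
structure IsMultiscaling {𝕜 : Type*} [RCLike 𝕜] {r : ℕ} (d : ℕ)
    (Pp Pm : ℤ → Matrix (Fin r) (Fin r) ℝ) (φ : ℝ → Fin r → 𝕜) : Prop where
  two_le : 2 ≤ d
  refinement : ∀ x : ℝ, HasSum
    (fun k : ℤ => (Real.sqrt d : 𝕜) •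
      ((Pp k).map (algebraMap ℝ 𝕜) *ᵥ φ ((d : ℝ) * x - k)
        + (Pm k).map (algebraMap ℝ 𝕜) *ᵥ φ (k - (d : ℝ) * x))) (φ x)
  multiresolution : IsMultiresolution d (scalingSpace d φ)
  stable : IsStable d φ

/-- Condition E for a complex matrix: `1` is a simple eigenvalue (a simple root of the
characteristic polynomial), and all other eigenvalues are smaller than `1` in absolute value. -/
def ConditionE {m : Type*} [Fintype m] [DecidableEq m] (A : Matrix m m ℂ) : Prop :=
  A.charpoly.rootMultiplicity 1 = 1 ∧
    ∀ μ : ℂ, Module.End.HasEigenvalue (Matrix.toLin' A) μ → μ ≠ 1 → ‖μ‖ < 1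

/-- The matrix `d^{-1/2} ∑_k [P_k^+, P_k^-; P_{-k}^-, P_{-k}^+]`. (If `φ` is orthogonal and
compactly supported, only finitely many of its recursion coefficients are nonzero.) -/
noncomputable def symbolAtOne {r : ℕ} (d : ℕ) (Pp Pm : ℤ → Matrix (Fin r) (Fin r) ℝ) :
    Matrix (Fin r ⊕ Fin r) (Fin r ⊕ Fin r) ℝ :=
  (Real.sqrt d)⁻¹ • ∑' k : ℤ, Matrix.fromBlocks (Pp k) (Pm k) (Pm (-k)) (Pp (-k))

/-- The `j`-th continuous moment `m_j = ∫ x^j φ(x) dx`, a vector of size `r`. -/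
noncomputable def moment {𝕜 : Type*} [RCLike 𝕜] {r : ℕ} (φ : ℝ → Fin r → 𝕜) (j : ℕ) :
    Fin r → 𝕜 :=
  fun i => ∫ x : ℝ, ((x ^ j : ℝ) : 𝕜) * φ x i

end TwoDirection

namespace TwoDirection

open Filter Topology

/-! The proof tests the density of the spaces `V n` on one function, the indicator `f` of `(0,1]`.
By orthogonality, the `2r` functions `φ_i(x)` and `φ_i(-x)`, written `ψ_a`, have orthonormal integer
translates, so with `N = d^n` the functions `√N ψ_a(Nx - k)` are an orthonormal basis of `V n`. The
squared norm of the projection of `f` onto `V n` is therefore the sum over `a` and `k` of `N⁻¹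
|∫_{-k}^{N-k} ψ_a|²`. Compact support makes about `N` of these windows see all of `ψ_a`, while a
number bounded independently of `N` meet an end of the support, so the sum tends to `∑ |∫ ψ_a|²`
(`tendsto_sum_windowIntegral`). Density makes the same quantity tend to `‖f‖² = 1`. Hence `∑ |∫
ψ_a|² = 1` (`sum_norm_integral_sq_eq_one`), and reflection leaves integrals unchanged, so each `φ_i`
is counted twice. -/

theorem norm_starProjection_sq_of_orthonormal {𝕜 E ι : Type*} [RCLike 𝕜] [NormedAddCommGroup E]
    [InnerProductSpace 𝕜 E] {v : ι → E} (hv : Orthonormal 𝕜 v) (f : E) (s : Finset ι)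
    (hs : ∀ i ∉ s, inner 𝕜 (v i) f = 0)
    [(Submodule.span 𝕜 (Set.range v)).topologicalClosure.HasOrthogonalProjection] :
    ‖(Submodule.span 𝕜 (Set.range v)).topologicalClosure.starProjection f‖ ^ 2
      = ∑ i ∈ s, ‖inner 𝕜 (v i) f‖ ^ 2 := by
  classical
  set g : E := ∑ i ∈ s, inner 𝕜 (v i) f • v i with hg
  have hproj : (Submodule.span 𝕜 (Set.range v)).topologicalClosure.starProjection f = g := by
    refine Submodule.eq_starProjection_of_mem_orthogonal ?_ ?_
    · exact Submodule.le_topologicalClosure _ <| Submodule.sum_mem _ fun i _ =>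
        Submodule.smul_mem _ _ (Submodule.subset_span ⟨i, rfl⟩)
    -- It suffices to test `f - g` against each `v i`: inside `s` the coefficients agree, outside
    -- `s` both inner products vanish.
    · rw [Submodule.orthogonal_closure]
      refine (Submodule.mem_orthogonal _ _).2 fun u hu => ?_
      induction hu using Submodule.span_induction with
      | mem x hx =>
        obtain ⟨i, rfl⟩ := hx
        rw [inner_sub_right, sub_eq_zero]
        by_cases hi : i ∈ s
        · rw [hg, hv.inner_right_sum _ hi]
        · rw [hs i hi, hg, inner_sum]
          refine (Finset.sum_eq_zero fun j hj => ?_).symm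
          rw [inner_smul_right, hv.2 (fun h : i = j => hi (h ▸ hj)), mul_zero]
      | zero => simp
      | add x y _ _ hx hy => rw [inner_add_left, hx, hy, add_zero]
      | smul a x _ hx => rw [inner_smul_left, hx, mul_zero]
  have h : ((‖g‖ ^ 2 : ℝ) : 𝕜) = ((∑ i ∈ s, ‖inner 𝕜 (v i) f‖ ^ 2 : ℝ) : 𝕜) := by
    push_cast
    rw [← inner_self_eq_norm_sq_to_K (𝕜 := 𝕜), hg, hv.inner_sum]
    exact Finset.sum_congr rfl fun i _ => RCLike.conj_mul _
  rw [hproj]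
  exact_mod_cast h

/-! ### Integrals of a compactly supported function over sliding windows -/

section Windows

variable {𝕜 : Type*} [RCLike 𝕜] {ψ : ℝ → 𝕜} {R : ℕ}

theorem windowIntegral_eq_integral (hR : ∀ x : ℝ, (R : ℝ) ≤ |x| → ψ x = 0) {N : ℕ} {k : ℤ}
    (h₁ : (R : ℤ) ≤ k) (h₂ : k ≤ N - R) :
    ∫ x in (-k : ℝ)..(N - k), ψ x = ∫ x, ψ x := by
  refine intervalIntegral.integral_eq_integral_of_support_subset fun x hx => ?_
  have hx' : |x| < R := by
    by_contra h
    exact hx (hR x (not_lt.1 h))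
  have h₁' : (R : ℝ) ≤ k := by exact_mod_cast h₁
  have h₂' : (k : ℝ) ≤ N - R := by exact_mod_cast h₂
  rw [abs_lt] at hx'
  constructor <;> linarith

theorem windowIntegral_eq_zero (hR : ∀ x : ℝ, (R : ℝ) ≤ |x| → ψ x = 0) {N : ℕ} {k : ℤ}
    (hk : k ∉ Finset.Icc (-R : ℤ) (N + R)) :
    ∫ x in (-k : ℝ)..(N - k), ψ x = 0 := by
  have hN : (0 : ℝ) ≤ N := Nat.cast_nonneg N
  rw [intervalIntegral.integral_congr (g := fun _ => (0 : 𝕜)), intervalIntegral.integral_zero]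
  intro x hx
  rw [Set.uIcc_of_le (by linarith)] at hx
  refine hR x ?_
  rw [Finset.mem_Icc, not_and_or, not_le, not_le] at hk
  rcases hk with hk | hk
  · have : (k : ℝ) < -R := by exact_mod_cast hk
    exact le_trans (by linarith [hx.1]) (le_abs_self x)
  · have : (N + R : ℝ) < k := by exact_mod_cast hk
    exact le_trans (by linarith [hx.2]) (neg_le_abs x)

theorem norm_windowIntegral_le (hψ : Integrable ψ) (N : ℕ) (k : ℤ) :
    ‖∫ x in (-k : ℝ)..(N - k), ψ x‖ ≤ ∫ x, ‖ψ x‖ := by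
  have hN : (0 : ℝ) ≤ N := Nat.cast_nonneg N
  rw [intervalIntegral.integral_of_le (by linarith)]
  exact (norm_integral_le_integral_norm _).trans
    (setIntegral_le_integral hψ.norm (Eventually.of_forall fun _ => norm_nonneg _))

/-- At most `4R` windows fail `R ≤ k ≤ N - R`, each with error at most `(∫ ‖ψ‖)²`; the `N + 2R + 1`
indices exceed `N` by `2R + 1`. This gives the constant `6R + 1`, also when `N < 2R`. -/
theorem abs_sum_windowIntegral_sub_le (hψ : Integrable ψ)
    (hR : ∀ x : ℝ, (R : ℝ) ≤ |x| → ψ x = 0) (N : ℕ) :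
    |∑ k ∈ Finset.Icc (-R : ℤ) (N + R), ‖∫ x in (-k : ℝ)..(N - k), ψ x‖ ^ 2
        - N * ‖∫ x, ψ x‖ ^ 2| ≤ (6 * R + 1) * (∫ x, ‖ψ x‖) ^ 2 := by
  classical
  set I := ∫ x, ‖ψ x‖
  set M := ‖∫ x, ψ x‖ ^ 2
  set T : ℤ → ℝ := fun k => ‖∫ x in (-k : ℝ)..(N - k), ψ x‖ ^ 2
  have hI : 0 ≤ I := integral_nonneg fun _ => norm_nonneg _
  have hM₀ : 0 ≤ M := sq_nonneg _
  have hM : M ≤ I ^ 2 := pow_le_pow_left₀ (norm_nonneg _) (norm_integral_le_integral_norm _) 2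
  have hT : ∀ k, T k ≤ I ^ 2 := fun k =>
    pow_le_pow_left₀ (norm_nonneg _) (norm_windowIntegral_le hψ N k) 2
  have hT₀ : ∀ k, 0 ≤ T k := fun k => sq_nonneg _
  have hdiff : |∑ k ∈ Finset.Icc (-R : ℤ) (N + R), (T k - M)| ≤ 4 * R * I ^ 2 := by
    calc |∑ k ∈ Finset.Icc (-R : ℤ) (N + R), (T k - M)|
        ≤ ∑ k ∈ Finset.Icc (-R : ℤ) (N + R), |T k - M| := Finset.abs_sum_le_sum_abs _ _
      _ ≤ ∑ k ∈ Finset.Icc (-R : ℤ) (N + R),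
            if k ∈ Finset.Icc (R : ℤ) (N - R) then 0 else I ^ 2 := by
          refine Finset.sum_le_sum fun k _ => ?_
          split_ifs with hk
          · rw [Finset.mem_Icc] at hk
            simp only [T, M, windowIntegral_eq_integral hR hk.1 hk.2, sub_self, abs_zero, le_refl]
          · rw [abs_le]
            constructor <;> linarith [hT k, hT₀ k]
      _ = ((Finset.Icc (-R : ℤ) (N + R)).filter
            (fun k => k ∉ Finset.Icc (R : ℤ) (N - R))).card * I ^ 2 := by
          rw [← nsmul_eq_mul, ← Finset.sum_const, Finset.sum_filter]
          exact Finset.sum_congr rfl fun k _ => by rw [ite_not]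
      _ ≤ 4 * R * I ^ 2 := by
          refine mul_le_mul_of_nonneg_right ?_ (sq_nonneg _)
          have hsub : (Finset.Icc (-R : ℤ) (N + R)).filter
              (fun k => k ∉ Finset.Icc (R : ℤ) (N - R))
              ⊆ Finset.Ico (-R : ℤ) R ∪ Finset.Ioc (N - R : ℤ) (N + R) := by
            intro k hk
            simp only [Finset.mem_filter, Finset.mem_Icc, Finset.mem_union, Finset.mem_Ico,
              Finset.mem_Ioc] at hk ⊢
            omega
          have hcard := (Finset.card_le_card hsub).trans (Finset.card_union_le _ _)
          rw [Int.card_Ico, Int.card_Ioc] at hcard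
          have : ((Finset.Icc (-R : ℤ) (N + R)).filter
              (fun k => k ∉ Finset.Icc (R : ℤ) (N - R))).card ≤ 4 * R := by omega
          exact_mod_cast this
  have hcount : ((Finset.Icc (-R : ℤ) (N + R)).card : ℝ) = N + 2 * R + 1 := by
    have : (Finset.Icc (-R : ℤ) (N + R)).card = N + 2 * R + 1 := by
      rw [Int.card_Icc]; omega
    rw [this]; push_cast; ring
  rw [Finset.sum_sub_distrib, Finset.sum_const, nsmul_eq_mul, hcount, abs_le] at hdiff
  have hR₀ : (0 : ℝ) ≤ R := Nat.cast_nonneg R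
  have h₁ : (2 * R + 1) * M ≤ (2 * R + 1) * I ^ 2 := by gcongr
  have h₂ : 0 ≤ (2 * R + 1) * M := by positivity
  rw [abs_le]
  constructor <;> linarith [hdiff.1, hdiff.2]

theorem tendsto_sum_windowIntegral (hψ : Integrable ψ)
    (hR : ∀ x : ℝ, (R : ℝ) ≤ |x| → ψ x = 0) :
    Tendsto (fun N : ℕ => (N : ℝ)⁻¹ *
      ∑ k ∈ Finset.Icc (-R : ℤ) (N + R), ‖∫ x in (-k : ℝ)..(N - k), ψ x‖ ^ 2)
      atTop (𝓝 (‖∫ x, ψ x‖ ^ 2)) := by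
  rw [tendsto_iff_norm_sub_tendsto_zero]
  have h : Tendsto (fun N : ℕ => (6 * R + 1) * (∫ x, ‖ψ x‖) ^ 2 * (N : ℝ)⁻¹) atTop (𝓝 0) := by
    have := (tendsto_inv_atTop_nhds_zero_nat (𝕜 := ℝ)).const_mul
      ((6 * (R : ℝ) + 1) * (∫ x, ‖ψ x‖) ^ 2)
    rwa [mul_zero] at this
  refine squeeze_zero' (Eventually.of_forall fun _ => norm_nonneg _) ?_ h
  filter_upwards [eventually_gt_atTop 0] with N hN
  have hN' : (0 : ℝ) < N := by exact_mod_cast hN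
  have hb := abs_sum_windowIntegral_sub_le hψ hR N
  rw [Real.norm_eq_abs, ← div_eq_mul_inv, le_div_iff₀ hN']
  refine le_trans (le_of_eq ?_) hb
  rw [← abs_of_pos hN', ← abs_mul, abs_of_pos hN', sub_mul, mul_assoc, mul_comm _ (N : ℝ),
    inv_mul_cancel_left₀ hN'.ne', mul_comm _ (N : ℝ)]

end Windows

/-! ### Orthonormal dilated translates and projection of an indicator -/

section DilatedTranslates

variable {𝕜 ι : Type*} [RCLike 𝕜] {ψ : ι → ℝ → 𝕜}

theorem memLp_dilatedTranslate (hc : ∀ a, Continuous (ψ a)) (hs : ∀ a, HasCompactSupport (ψ a))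
    {N : ℝ} (hN : 0 < N) (e : ι × ℤ) :
    MemLp (fun x : ℝ => ((√N : ℝ) : 𝕜) * ψ e.1 (N * x - e.2)) 2 volume := by
  have hcomp : HasCompactSupport (fun x : ℝ => ψ e.1 (N * x - e.2)) :=
    (hs e.1).comp_homeomorph ((Homeomorph.mulLeft₀ N hN.ne').trans (Homeomorph.subRight (e.2 : ℝ)))
  have hcont : Continuous (fun x : ℝ => ψ e.1 (N * x - e.2)) := by
    have := hc e.1
    fun_prop
  exact (hcont.memLp_of_hasCompactSupport hcomp).const_mul _

/-- The normalized functions `√N ψ_a(N x - k)` as elements of `L²(ℝ)`. -/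
noncomputable def dilatedTranslate (hc : ∀ a, Continuous (ψ a))
    (hs : ∀ a, HasCompactSupport (ψ a)) {N : ℝ} (hN : 0 < N) (e : ι × ℤ) :
    Lp 𝕜 2 (volume : Measure ℝ) :=
  (memLp_dilatedTranslate hc hs hN e).toLp _

theorem coeFn_dilatedTranslate (hc : ∀ a, Continuous (ψ a))
    (hs : ∀ a, HasCompactSupport (ψ a)) {N : ℝ} (hN : 0 < N) (e : ι × ℤ) :
    dilatedTranslate hc hs hN e
      =ᵐ[volume] fun x : ℝ => ((√N : ℝ) : 𝕜) * ψ e.1 (N * x - e.2) :=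
  MemLp.coeFn_toLp _

theorem ofReal_sqrt_ne_zero {N : ℝ} (hN : 0 < N) : ((√N : ℝ) : 𝕜) ≠ 0 :=
  RCLike.ofReal_ne_zero.2 (Real.sqrt_pos.2 hN).ne'

theorem span_dilatedTranslate (hc : ∀ a, Continuous (ψ a))
    (hs : ∀ a, HasCompactSupport (ψ a)) {N : ℝ} (hN : 0 < N) :
    Submodule.span 𝕜 (Set.range (dilatedTranslate hc hs hN))
      = Submodule.span 𝕜 {f : Lp 𝕜 2 (volume : Measure ℝ) |
          ∃ e : ι × ℤ, f =ᵐ[volume] fun x => ψ e.1 (N * x - e.2)} := by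
  apply le_antisymm <;> rw [Submodule.span_le]
  · rintro _ ⟨e, rfl⟩
    have hmem : ((√N : ℝ) : 𝕜)⁻¹ • dilatedTranslate hc hs hN e
        ∈ Submodule.span 𝕜 {f : Lp 𝕜 2 (volume : Measure ℝ) |
          ∃ e : ι × ℤ, f =ᵐ[volume] fun x => ψ e.1 (N * x - e.2)} := by
      refine Submodule.subset_span ⟨e, ?_⟩
      filter_upwards [Lp.coeFn_smul (((√N : ℝ) : 𝕜)⁻¹) (dilatedTranslate hc hs hN e),
        coeFn_dilatedTranslate hc hs hN e] with x h₁ h₂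
      rw [h₁, Pi.smul_apply, h₂, smul_eq_mul, inv_mul_cancel_left₀ (ofReal_sqrt_ne_zero hN)]
    simpa [smul_smul, ofReal_sqrt_ne_zero (𝕜 := 𝕜) hN]
      using Submodule.smul_mem _ ((√N : ℝ) : 𝕜) hmem
  · rintro f ⟨e, hf⟩
    have : f = ((√N : ℝ) : 𝕜)⁻¹ • dilatedTranslate hc hs hN e := by
      apply Lp.ext
      filter_upwards [hf, Lp.coeFn_smul (((√N : ℝ) : 𝕜)⁻¹) (dilatedTranslate hc hs hN e),
        coeFn_dilatedTranslate hc hs hN e] with x h₀ h₁ h₂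
      rw [h₀, h₁, Pi.smul_apply, h₂, smul_eq_mul, inv_mul_cancel_left₀ (ofReal_sqrt_ne_zero hN)]
    rw [this]
    exact Submodule.smul_mem _ _ (Submodule.subset_span ⟨e, rfl⟩)

theorem orthonormal_dilatedTranslate [DecidableEq ι] (hc : ∀ a, Continuous (ψ a))
    (hs : ∀ a, HasCompactSupport (ψ a))
    (ho : ∀ (a b : ι) (j k : ℤ), ∫ x : ℝ, ψ a (x - j) * star (ψ b (x - k))
      = if a = b ∧ j = k then 1 else 0)
    {N : ℝ} (hN : 0 < N) : Orthonormal 𝕜 (dilatedTranslate hc hs hN) := by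
  rw [orthonormal_iff_ite]
  rintro ⟨a, j⟩ ⟨b, k⟩
  rw [L2.inner_def]
  have h : ∫ x : ℝ, inner 𝕜 (dilatedTranslate hc hs hN (a, j) x)
      (dilatedTranslate hc hs hN (b, k) x)
      = ∫ x : ℝ, (N : 𝕜) * (fun y : ℝ => ψ b (y - k) * star (ψ a (y - j))) (N * x) := by
    refine integral_congr_ae ?_
    filter_upwards [coeFn_dilatedTranslate hc hs hN (a, j),
      coeFn_dilatedTranslate hc hs hN (b, k)] with x h₁ h₂
    have hsq : ((√N : ℝ) : 𝕜) * ((√N : ℝ) : 𝕜) = (N : 𝕜) := by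
      rw [← RCLike.ofReal_mul, Real.mul_self_sqrt hN.le]
    simp only [h₁, h₂, RCLike.inner_apply, map_mul, RCLike.conj_ofReal, RCLike.star_def, ← hsq]
    ring
  rw [h, integral_const_mul,
    Measure.integral_comp_mul_left (fun y : ℝ => ψ b (y - k) * star (ψ a (y - j))), ho, abs_of_pos (inv_pos.2 hN),
    RCLike.real_smul_eq_coe_mul, RCLike.ofReal_inv, mul_inv_cancel_left₀
      (RCLike.ofReal_ne_zero.2 hN.ne')]
  simp [Prod.mk.injEq, eq_comm]

/-- Substituting `y = Nx - k` carries `(0,1]` to the window and leaves the factor `√N / N`, whose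
square is `N⁻¹`. -/
theorem norm_inner_dilatedTranslate_indicator_sq (hc : ∀ a, Continuous (ψ a))
    (hs : ∀ a, HasCompactSupport (ψ a)) {N : ℝ} (hN : 0 < N)
    (hμ : volume (Set.Ioc (0 : ℝ) 1) ≠ ⊤) (e : ι × ℤ) :
    ‖inner 𝕜 (dilatedTranslate hc hs hN e)
        (indicatorConstLp 2 measurableSet_Ioc hμ (1 : 𝕜))‖ ^ 2
      = N⁻¹ * ‖∫ x in (-e.2 : ℝ)..(N - e.2), ψ e.1 x‖ ^ 2 := by
  rw [norm_inner_symm, L2.inner_indicatorConstLp_one,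
    setIntegral_congr_ae (g := fun x : ℝ => ((√N : ℝ) : 𝕜) * ψ e.1 (N * x - e.2))
      measurableSet_Ioc ((coeFn_dilatedTranslate hc hs hN e).mono fun x hx _ => hx),
    ← intervalIntegral.integral_of_le zero_le_one, intervalIntegral.integral_const_mul,
    intervalIntegral.integral_comp_mul_sub _ hN.ne', mul_zero, mul_one, zero_sub, norm_mul,
    norm_smul, RCLike.norm_ofReal, abs_of_nonneg (Real.sqrt_nonneg N), mul_pow, mul_pow,
    Real.sq_sqrt hN.le, norm_inv, Real.norm_of_nonneg hN.le]
  field_simp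

/-- If the integer translates of finitely many compactly supported functions `ψ_a` are orthonormal
and the closed spans of their dilates `ψ_a(d^n x - k)` increase to `L²(ℝ)`, then
`∑_a |∫ ψ_a|² = 1`. -/
theorem sum_norm_integral_sq_eq_one [Fintype ι] [DecidableEq ι] {d : ℕ} (hd : 2 ≤ d)
    (hc : ∀ a, Continuous (ψ a)) (hs : ∀ a, HasCompactSupport (ψ a))
    (ho : ∀ (a b : ι) (j k : ℤ), ∫ x : ℝ, ψ a (x - j) * star (ψ b (x - k))
      = if a = b ∧ j = k then 1 else 0)
    (W : ℕ → Submodule 𝕜 (Lp 𝕜 2 (volume : Measure ℝ)))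
    (hW : ∀ n, W n = (Submodule.span 𝕜 {f : Lp 𝕜 2 (volume : Measure ℝ) |
      ∃ e : ι × ℤ, f =ᵐ[volume] fun x => ψ e.1 ((d : ℝ) ^ n * x - e.2)}).topologicalClosure)
    (hmono : Monotone W) (hdense : ⊤ ≤ (⨆ n, W n).topologicalClosure) :
    ∑ a, ‖∫ x, ψ a x‖ ^ 2 = 1 := by
  have hint : ∀ a, Integrable (ψ a) := fun a => (hc a).integrable_of_hasCompactSupport (hs a)
  obtain ⟨R, hR⟩ : ∃ R : ℕ, ∀ a, ∀ x : ℝ, (R : ℝ) ≤ |x| → ψ a x = 0 := by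
    have h : ∀ a, ∃ C : ℝ, ∀ x : ℝ, C ≤ |x| → ψ a x = 0 := fun a => by
      obtain ⟨C, _, hC⟩ := (hs a).exists_pos_le_norm
      exact ⟨C, hC⟩
    choose C hC using h
    -- The sum dominates every `|C a|`, giving one radius for all `a`.
    obtain ⟨R, hR⟩ := exists_nat_ge (∑ a, |C a|)
    refine ⟨R, fun a x hx => hC a x ?_⟩
    exact (le_abs_self _).trans <| (Finset.single_le_sum (f := fun a => |C a|)
      (fun _ _ => abs_nonneg _) (Finset.mem_univ a)).trans (hR.trans hx)
  have hμ : volume (Set.Ioc (0 : ℝ) 1) ≠ ⊤ := measure_Ioc_lt_top.ne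
  set f : Lp 𝕜 2 (volume : Measure ℝ) := indicatorConstLp 2 measurableSet_Ioc hμ (1 : 𝕜) with hf
  have hnorm : ‖f‖ = 1 := by
    rw [hf, norm_indicatorConstLp (by norm_num) (by norm_num)]
    simp
  have hclosed : ∀ n, IsClosed (W n : Set (Lp 𝕜 2 (volume : Measure ℝ))) := fun n => by
    rw [hW]
    exact Submodule.isClosed_topologicalClosure _
  have hcomplete : ∀ n, CompleteSpace (W n) := fun n => (hclosed n).completeSpace_coe
  have hlim : Tendsto (fun n => ‖(W n).starProjection f‖ ^ 2) atTop (𝓝 1) := by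
    have := ((Submodule.starProjection_tendsto_self W hmono f hdense).norm).pow 2
    rwa [hnorm, one_pow] at this
  have hproj : ∀ n, ‖(W n).starProjection f‖ ^ 2
      = ∑ a, (((d ^ n : ℕ) : ℝ)⁻¹ * ∑ k ∈ Finset.Icc (-R : ℤ) ((d ^ n : ℕ) + R),
          ‖∫ x in (-k : ℝ)..((d ^ n : ℕ) - k), ψ a x‖ ^ 2) := fun n => by
    have hN : (0 : ℝ) < (d ^ n : ℕ) := by
      have : 0 < d ^ n := by positivity
      exact_mod_cast this
    have hWn : W n = (Submodule.span 𝕜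
        (Set.range (dilatedTranslate hc hs hN))).topologicalClosure := by
      rw [span_dilatedTranslate, hW, Nat.cast_pow]
    have hcp : CompleteSpace (Submodule.span 𝕜
        (Set.range (dilatedTranslate hc hs hN))).topologicalClosure :=
      (Submodule.isClosed_topologicalClosure _).completeSpace_coe
    have key := norm_starProjection_sq_of_orthonormal
      (orthonormal_dilatedTranslate hc hs ho hN) f
      (Finset.univ ×ˢ Finset.Icc (-R : ℤ) ((d ^ n : ℕ) + R)) (fun e he => by
        have hk : e.2 ∉ Finset.Icc (-R : ℤ) ((d ^ n : ℕ) + R) := fun h =>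
          he (Finset.mem_product.2 ⟨Finset.mem_univ _, h⟩)
        have h := norm_inner_dilatedTranslate_indicator_sq hc hs hN hμ e
        rw [windowIntegral_eq_zero (hR e.1) hk, norm_zero] at h
        simpa using h)
    simp_rw [hf, norm_inner_dilatedTranslate_indicator_sq, Finset.sum_product,
      ← Finset.mul_sum] at key
    simp_rw [← Finset.mul_sum]
    rw [← key]
    -- The projection instance depends on the subspace, so `hWn` is applied by congruence.
    congr!
  have hlim' : Tendsto (fun n => ‖(W n).starProjection f‖ ^ 2) atTop
      (𝓝 (∑ a, ‖∫ x, ψ a x‖ ^ 2)) := by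
    simp_rw [hproj]
    exact tendsto_finsetSum _ fun a _ => (tendsto_sum_windowIntegral (hint a) (hR a)).comp
      (tendsto_pow_atTop_atTop_of_one_lt hd)
  exact tendsto_nhds_unique hlim' hlim

end DilatedTranslates

/-! ### Reduction of the two-direction setting to ordinary translates -/

/-- The components of `φ(x)` and of `φ(-x)`. -/
def twoSided {𝕜 : Type*} {r : ℕ} (φ : ℝ → Fin r → 𝕜) : Fin r ⊕ Fin r → ℝ → 𝕜
  | Sum.inl i => fun x => φ x i
  | Sum.inr i => fun x => φ (-x) i

/-- The reflected-unreflected case is the conjugate of `cross`; the doubly reflected one becomes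
`same` under `x ↦ -x`, with `j` and `k` negated. -/
theorem IsOrthogonal.integral_twoSided {𝕜 : Type*} [RCLike 𝕜] {r : ℕ} {φ : ℝ → Fin r → 𝕜}
    (h : IsOrthogonal φ) (a b : Fin r ⊕ Fin r) (j k : ℤ) :
    ∫ x : ℝ, twoSided φ a (x - j) * star (twoSided φ b (x - k))
      = if a = b ∧ j = k then 1 else 0 := by
  have hsame : ∀ (i l : Fin r) (j k : ℤ), ∫ x : ℝ, φ (x - j) i * star (φ (x - k) l)
      = if i = l ∧ j = k then 1 else 0 := fun i l j k => by
    have := congrFun (congrFun (h.same j k) i) l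
    rw [innerMatrix, Matrix.of_apply] at this
    rw [this]
    by_cases hjk : j = k <;> simp [hjk, Matrix.one_apply]
  have hcross : ∀ (i l : Fin r) (j k : ℤ), ∫ x : ℝ, φ (x - j) i * star (φ (k - x) l) = 0 :=
    fun i l j k => congrFun (congrFun (h.cross j k) i) l
  rcases a with i | i <;> rcases b with l | l <;> simp only [twoSided, neg_sub]
  · simpa using hsame i l j k
  · simpa using hcross i l j k
  · have := congrArg star (hcross l i k j)
    rw [RCLike.star_def, ← integral_conj] at this
    simpa [mul_comm] using this
  · rw [← integral_neg_eq_self]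
    have := hsame i l (-j) (-k)
    simpa [add_comm] using this

theorem scalingSpace_natCast {𝕜 : Type*} [RCLike 𝕜] {r : ℕ} (d : ℕ) (φ : ℝ → Fin r → 𝕜) (n : ℕ) :
    scalingSpace d φ n = (Submodule.span 𝕜 {f : Lp 𝕜 2 (volume : Measure ℝ) |
      ∃ e : (Fin r ⊕ Fin r) × ℤ,
        f =ᵐ[volume] fun x => twoSided φ e.1 ((d : ℝ) ^ n * x - e.2)}).topologicalClosure := by
  rw [scalingSpace]
  congr 2
  ext f
  simp [dilates, twoSided, Prod.exists, Sum.exists, exists_comm (α := ℤ)]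

/-- By nestedness the spaces of negative index lie in `V 0`, so they add nothing to the union. -/
theorem IsMultiresolution.top_le_closure_iSup_nat {𝕜 : Type*} [RCLike 𝕜] {d : ℕ}
    {V : ℤ → Submodule 𝕜 (Lp 𝕜 2 (volume : Measure ℝ))} (h : IsMultiresolution d V) :
    ⊤ ≤ (⨆ n : ℕ, V n).topologicalClosure := by
  have hmono : Monotone V := monotone_int_of_le_succ h.nested
  intro f _
  refine closure_mono ?_ (h.dense f)
  refine Set.iUnion_subset fun n => ?_
  exact (hmono (Int.self_le_toNat n)).trans (le_iSup (fun n : ℕ => V n) n.toNat)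

end TwoDirection

theorem theorem3p3 {𝕜 : Type*} [RCLike 𝕜] {d r : ℕ}
    (Pp Pm : ℤ → Matrix (Fin r) (Fin r) ℝ) (φ : ℝ → Fin r → 𝕜)
    (hφ : TwoDirection.IsMultiscaling d Pp Pm φ)
    (horth : TwoDirection.IsOrthogonal φ)
    (hsupp : HasCompactSupport φ)
    (hcont : Continuous φ)
    (hE : TwoDirection.ConditionE
      ((TwoDirection.symbolAtOne d Pp Pm).map (algebraMap ℝ ℂ))) :
    star (TwoDirection.moment φ 0) ⬝ᵥ TwoDirection.moment φ 0 = 1 / 2 := by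
  have hV := hφ.multiresolution
  have hmono : Monotone (TwoDirection.scalingSpace d φ) := monotone_int_of_le_succ hV.nested
  have hsupp' : ∀ i, HasCompactSupport fun x => φ x i := fun i =>
    hsupp.comp_left (g := fun v : Fin r → 𝕜 => v i) rfl
  have key := TwoDirection.sum_norm_integral_sq_eq_one (ψ := TwoDirection.twoSided φ) hφ.two_le
    (by
      rintro (i | i)
      · exact (continuous_apply i).comp hcont
      · exact (continuous_apply i).comp (hcont.comp continuous_neg))
    (by
      rintro (i | i)
      · exact hsupp' i
      · exact (hsupp' i).comp_homeomorph (Homeomorph.neg ℝ))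
    horth.integral_twoSided (fun n : ℕ => TwoDirection.scalingSpace d φ n)
    (TwoDirection.scalingSpace_natCast d φ) (fun m n hmn => hmono (by exact_mod_cast hmn))
    hV.top_le_closure_iSup_nat
  rw [Fintype.sum_sum_type] at key
  simp only [TwoDirection.twoSided] at key
  -- Both halves of the sum over `Fin r ⊕ Fin r` are equal, which is the source of the factor `1/2`.
  have hneg : ∀ i, ∫ x, φ (-x) i = ∫ x, φ x i := fun i =>
    integral_neg_eq_self (fun x => φ x i) volume
  simp only [hneg] at key
  have hhalf : ∑ i, ‖∫ x, φ x i‖ ^ 2 = 1 / 2 := by linarith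
  have hdot : star (TwoDirection.moment φ 0) ⬝ᵥ TwoDirection.moment φ 0
      = ((∑ i, ‖∫ x, φ x i‖ ^ 2 : ℝ) : 𝕜) := by
    push_cast
    refine Finset.sum_congr rfl fun i _ => ?_
    simp [TwoDirection.moment, RCLike.conj_mul]
  rw [hdot, hhalf]
  push_cast
  rfl
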